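/- Let $\mathcal{E}_{2,2}$ be the ensemble of random qubit density matrices obtained by taking the partial trace over the second factor of a Haar-distributed pure state of $\mathbb{C}^2\otimes\mathbb{C}^2$. Every qubit density matrix is uniquely of the form $\rho(\boldsymbol r)=\frac12(\mathbb 1_2+r_x\sigma_x+r_y\sigma_y+r_z\sigma_z)$ with Pauli matrices $\sigma_x,\sigma_y,\sigma_z$ and Bloch vector $\boldsymbol r=(r_x,r_y,r_z)\in\mathbb{R}^3$, $|\boldsymbol r|\leqslant 1$. Let $\rho_1,\rho_2$ be independent random states, each distributed according to $\mathcal{E}_{2,2}$. Then for every $w\in(\frac12,1)$ the length $r=|\boldsymbol r|\in[0,1]$ of the Bloch vector of the mixture $w\rho_1+(1-w)\rho_2$ has a continuous probability density function $p^{(2)}_w$, which vanishes outside $[0,1]$ and is given on $[0,1]$ by $$p^{(2)}_w(r)=\begin{cases}\dfrac{3(1-r)^2\,r\,(r^2+2r-12w^2+12w-3)}{16w^3(1-w)^3}, & r\in[2w-1,1],\\[2mm] \dfrac{3r^2}{w^3}, & r\in[0,2w-1].\end{cases}$$ Moreover, $\lim_{w\nearrow1}p^{(2)}_w(r)=3r^2$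 for every $r\in[0,1)$, and $\lim_{w\searrow\frac12}p^{(2)}_w(r)=12r^2(r^3-3r+2)$ for every $r\in[0,1]$. -/

import Mathlib

open MeasureTheory ProbabilityTheory Filter Set
open scoped Topology Matrix

/-- The entrywise (equivalently, Borel) measurable structure on complex matrices. -/
noncomputable instance matrixMeasurableSpace {m n : Type*} : MeasurableSpace (Matrix m n ℂ) :=
  inferInstanceAs (MeasurableSpace (m → n → ℂ))

/-- The law of a Haar-distributed pure state vector of a composite system `ℂ^d ⊗ ℂ^k`: the
normalised (unitarily invariant) surface measure of the unit sphere of `ℂ^d ⊗ ℂ^k`, whose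
vectors are given by their `d * k` coordinates in the product basis. -/
noncomputable def haarPureState (d k : ℕ) :
    Measure (Metric.sphere (0 : EuclideanSpace ℂ (Fin d × Fin k)) 1) :=
  ((volume : Measure (EuclideanSpace ℂ (Fin d × Fin k))).toSphere univ)⁻¹ •
    (volume : Measure (EuclideanSpace ℂ (Fin d × Fin k))).toSphere

/-- The rank-one projector `|ψ⟩⟨ψ|` of a state vector, as a matrix. -/
def pureDensity {ι : Type*} (ψ : EuclideanSpace ℂ ι) : Matrix ι ι ℂ :=
  Matrix.of fun i j => ψ i * star (ψ j)

/-- The partial trace over the second (`k`-dimensional) subsystem. -/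
def partialTraceRight {d k : ℕ} (M : Matrix (Fin d × Fin k) (Fin d × Fin k) ℂ) :
    Matrix (Fin d) (Fin d) ℂ :=
  Matrix.of fun i j => ∑ a : Fin k, M (i, a) (j, a)

/-- The random state ensemble `𝓔_{d,k}`, as a law on `d × d` matrices: the partial trace over the
`k`-dimensional subsystem of a Haar-distributed pure state of `ℂ^d ⊗ ℂ^k`. -/
noncomputable def stateEnsemble (d k : ℕ) : Measure (Matrix (Fin d) (Fin d) ℂ) :=
  (haarPureState d k).map fun ψ => partialTraceRight (pureDensity ψ.1)

/-- The Pauli matrices `σ_x, σ_y, σ_z`. -/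
def pauli : Fin 3 → Matrix (Fin 2) (Fin 2) ℂ :=
  ![!![0, 1; 1, 0], !![0, -Complex.I; Complex.I, 0], !![1, 0; 0, -1]]

/-- The Bloch representation `ρ(r) = (1 + r · σ) / 2`. -/
noncomputable def blochRep (r : EuclideanSpace ℝ (Fin 3)) : Matrix (Fin 2) (Fin 2) ℂ :=
  (1 / 2 : ℂ) • (1 + ∑ i, (r i : ℂ) • pauli i)

/-- The Bloch vector of a qubit state, with coordinates `Tr (ρ σ_i)`; on Hermitian matrices of
trace one it is the inverse of `blochRep` (see `blochRep_blochVector`, `blochVector_blochRep`). -/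
noncomputable def blochVector (ρ : Matrix (Fin 2) (Fin 2) ℂ) : EuclideanSpace ℝ (Fin 3) :=
  WithLp.toLp 2 fun i => (ρ * pauli i).trace.re

theorem blochVector_blochRep (r : EuclideanSpace ℝ (Fin 3)) : blochVector (blochRep r) = r := by
  ext i
  fin_cases i <;>
    simp [blochVector, blochRep, pauli, Fin.sum_univ_three, Matrix.trace, Matrix.mul_apply] <;>
    ring

theorem blochRep_blochVector (ρ : Matrix (Fin 2) (Fin 2) ℂ) (hρ : ρ.IsHermitian)
    (htr : ρ.trace = 1) : blochRep (blochVector ρ) = ρ := by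
  have h00 := hρ.apply 0 0
  have h11 := hρ.apply 1 1
  have h01 := hρ.apply 0 1
  rw [Matrix.trace_fin_two] at htr
  simp only [Complex.ext_iff, Complex.star_def, Complex.conj_re, Complex.conj_im, Complex.add_re,
    Complex.add_im, Complex.one_re, Complex.one_im] at h00 h11 h01 htr
  ext i j
  fin_cases i <;> fin_cases j <;> apply Complex.ext <;>
    simp [blochVector, blochRep, pauli, Fin.sum_univ_three, Matrix.trace, Matrix.mul_apply] <;>
    linarith [h00.2, h11.2, h01.1, h01.2, htr.1, htr.2]

/-- `p` is a probability density function, on `ℝ` with Lebesgue measure, of the real random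
variable `X`. -/
def IsDensityOf {Ω : Type*} [MeasurableSpace Ω] (p : ℝ → ℝ) (X : Ω → ℝ) (P : Measure Ω) : Prop :=
  Measurable p ∧ (∀ r, 0 ≤ p r) ∧ HasPDF X P volume ∧
    pdf X P volume =ᵐ[volume] fun r => ENNReal.ofReal (p r)

/-!
The argument has two halves: a reduced state of a Haar vector of `ℂ² ⊗ ℂ²` has a Bloch vector
uniformly distributed in the unit ball of `ℝ³`, and the law of `‖w x + (1 - w) y‖` for independent
uniform points `x`, `y` of that ball is governed by the volume of a spherical lens.

For the first half, write the coefficients of a vector of `ℂ² ⊗ ℂ²` as two rows `x, y ∈ ℂ²`. The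
reduced matrix is their Gram matrix, with entries `s = ‖x‖²`, `q = ‖y‖²` and `z = ⟪x, y⟫`. For fixed
`x ≠ 0`, a unitary change of variables in `y` makes `z / ‖x‖` a coordinate of `y`; the other
coordinate contributes to `q` through its squared modulus, which has constant density. The two
factors `s` (density of `‖x‖²`) and `1 / s` (Jacobian of `z`) cancel, so Lebesgue measure on `ℂ⁴` is
pushed forward to a multiple of Lebesgue measure on the cone `|z|² < s q`
(`exists_lintegral_gramCoord`). Sections of this cone at constant trace are round balls, and dividing
by the trace gives the uniform law on the unit ball (`exists_lintegral_gramCone`,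
`map_blochVector_stateEnsemble`).

For the second half, two linear substitutions and Tonelli's theorem turn the law of
`X = w x + (1 - w) y` into the density `vol (B(0, w) ∩ B(X, 1 - w))` up to a constant
(`lintegral_norm_uniformBall_mixture`). This volume depends only on `‖X‖`: it is a whole ball for
`‖X‖ ≤ 2 w - 1`, a lens for `2 w - 1 ≤ ‖X‖ ≤ 1` (`volume_ball_inter_ball`), and `0` for `‖X‖ ≥ 1`.
Polar coordinates in `ℝ³` then give the density of `‖X‖`.
-/

/-! ### Polar coordinates and substitutions for the Lebesgue integral -/

/-- Polar coordinates for radial functions, for the Lebesgue integral. -/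
theorem lintegral_fun_norm_eq {E : Type*} [NormedAddCommGroup E] [NormedSpace ℝ E]
    [FiniteDimensional ℝ E] [MeasurableSpace E] [BorelSpace E] [Nontrivial E] (μ : Measure E)
    [μ.IsAddHaarMeasure] {f : ℝ → ENNReal} (hf : Measurable f) :
    ∫⁻ x, f ‖x‖ ∂μ = μ.toSphere univ *
      ∫⁻ r in Ioi (0 : ℝ), ENNReal.ofReal (r ^ (Module.finrank ℝ E - 1)) * f r :=
  calc
    ∫⁻ x, f ‖x‖ ∂μ = ∫⁻ x : ({(0)}ᶜ : Set E), f ‖x.1‖ ∂(μ.comap (↑)) := by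
      rw [lintegral_subtype_comap (measurableSet_singleton _).compl fun x ↦ f ‖x‖,
        restrict_compl_singleton]
    _ = ∫⁻ x, f x.2 ∂μ.toSphere.prod (.volumeIoiPow (Module.finrank ℝ E - 1)) := by
      simpa using μ.measurePreserving_homeomorphUnitSphereProd.lintegral_comp_emb
        (Homeomorph.measurableEmbedding _) (f ∘ Subtype.val ∘ Prod.snd)
    _ = μ.toSphere univ *
        ∫⁻ x : Ioi (0 : ℝ), f x ∂.volumeIoiPow (Module.finrank ℝ E - 1) := by
      rw [lintegral_prod _ (by fun_prop)]
      simp [mul_comm]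
    _ = _ := by
      rw [Measure.volumeIoiPow, lintegral_withDensity_eq_lintegral_mul _ (by fun_prop)
        (by fun_prop)]
      congr 1
      exact lintegral_subtype_comap measurableSet_Ioi
        fun r : ℝ ↦ ENNReal.ofReal (r ^ (Module.finrank ℝ E - 1)) * f r

/-- The substitution `s = r ^ 2` on the half-line. -/
theorem lintegral_Ioi_comp_sq (f : ℝ → ENNReal) :
    ∫⁻ r in Ioi (0 : ℝ), ENNReal.ofReal (2 * r) * f (r ^ 2) = ∫⁻ s in Ioi (0 : ℝ), f s := by
  have himg : (fun r : ℝ ↦ r ^ 2) '' Ioi 0 = Ioi 0 := by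
    ext s
    constructor
    · rintro ⟨r, hr, rfl⟩
      exact pow_pos (mem_Ioi.1 hr) 2
    · intro hs
      exact ⟨√s, Real.sqrt_pos.2 hs, Real.sq_sqrt (le_of_lt hs)⟩
  have hinj : InjOn (fun r : ℝ ↦ r ^ 2) (Ioi 0) := fun a ha b hb h ↦
    (pow_left_inj₀ (le_of_lt ha) (le_of_lt hb) two_ne_zero).1 h
  have h := lintegral_image_eq_lintegral_abs_deriv_mul measurableSet_Ioi
    (fun x _ ↦ ((hasDerivAt_pow 2 x).hasDerivWithinAt : HasDerivWithinAt _ _ (Ioi (0 : ℝ)) x))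
    hinj f
  rw [himg] at h
  rw [h]
  refine setLIntegral_congr_fun measurableSet_Ioi fun r hr ↦ ?_
  have : (0 : ℝ) < r := hr
  simp [abs_of_pos this]

/-- The substitution `x = c • y + a` on a real normed space. -/
theorem lintegral_comp_smul_add {E : Type*} [NormedAddCommGroup E] [NormedSpace ℝ E]
    [FiniteDimensional ℝ E] [MeasurableSpace E] [BorelSpace E] (μ : Measure E)
    [μ.IsAddHaarMeasure] {f : E → ENNReal} (hf : Measurable f) {c : ℝ} (hc : c ≠ 0) (a : E) :
    ENNReal.ofReal (|c| ^ Module.finrank ℝ E) * ∫⁻ y, f (c • y + a) ∂μ = ∫⁻ x, f x ∂μ := by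
  have h : ∫⁻ y, f (c • y + a) ∂μ = ∫⁻ y, f (y + a) ∂(μ.map fun y ↦ c • y) := by
    rw [lintegral_map (by fun_prop) (by fun_prop)]
  rw [h, Measure.map_addHaar_smul μ hc, lintegral_smul_measure, lintegral_add_right_eq_self,
    smul_eq_mul, ← mul_assoc, ← ENNReal.ofReal_mul (by positivity), abs_inv, abs_pow,
    mul_inv_cancel₀ (by positivity)]
  simp

/-- In the complex plane, `|v|²` has a constant density on the half-line. -/
theorem exists_lintegral_complex_normSq : ∃ c : ENNReal, ∀ f : ℝ → ENNReal, Measurable f →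
    ∫⁻ v : ℂ, f (‖v‖ ^ 2) = c * ∫⁻ t in Ioi (0 : ℝ), f t := by
  refine ⟨(volume : Measure ℂ).toSphere univ * ENNReal.ofReal (1 / 2), fun f hf ↦ ?_⟩
  rw [lintegral_fun_norm_eq (f := fun r ↦ f (r ^ 2)) volume (by fun_prop),
    ← lintegral_Ioi_comp_sq (fun s ↦ f s), mul_assoc, ← lintegral_const_mul (ENNReal.ofReal (1 / 2)) (by fun_prop)]
  congr 1
  refine lintegral_congr fun r ↦ ?_
  rw [← mul_assoc, ← ENNReal.ofReal_mul (by norm_num), Complex.finrank_real_complex]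
  congr 2
  ring

/-- In the complex plane `ℂ²`, `‖x‖²` has a density proportional to `s` on the half-line. -/
theorem exists_lintegral_complex_sq_normSq : ∃ c : ENNReal, ∀ f : ℝ → ENNReal, Measurable f →
    ∫⁻ x : EuclideanSpace ℂ (Fin 2), f (‖x‖ ^ 2) =
      c * ∫⁻ s in Ioi (0 : ℝ), ENNReal.ofReal s * f s := by
  have hfin : Module.finrank ℝ (EuclideanSpace ℂ (Fin 2)) = 4 := by
    rw [← Module.finrank_mul_finrank ℝ ℂ]; simp
  refine ⟨(volume : Measure (EuclideanSpace ℂ (Fin 2))).toSphere univ * ENNReal.ofReal (1 / 2),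
    fun f hf ↦ ?_⟩
  rw [lintegral_fun_norm_eq (f := fun r ↦ f (r ^ 2)) volume (by fun_prop),
    ← lintegral_Ioi_comp_sq (fun s ↦ ENNReal.ofReal s * f s), mul_assoc, ← lintegral_const_mul (ENNReal.ofReal (1 / 2)) (by fun_prop)]
  congr 1
  refine setLIntegral_congr_fun measurableSet_Ioi fun r hr ↦ ?_
  have hr : (0 : ℝ) < r := hr
  rw [← mul_assoc, ← mul_assoc, ← ENNReal.ofReal_mul (by norm_num),
    ← ENNReal.ofReal_mul (by positivity), hfin]
  congr 2
  norm_num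
  ring

/-! ### Volume-preserving coordinates -/

theorem measurePreserving_of_norm_map {E F : Type*} [NormedAddCommGroup E]
    [InnerProductSpace ℝ E] [FiniteDimensional ℝ E] [MeasurableSpace E] [BorelSpace E]
    [NormedAddCommGroup F] [InnerProductSpace ℝ F] [FiniteDimensional ℝ F] [MeasurableSpace F]
    [BorelSpace F] (f : E →ₗ[ℝ] F) (hf : ∀ x, ‖f x‖ = ‖x‖)
    (h : Module.finrank ℝ E = Module.finrank ℝ F) :
    MeasurePreserving f volume volume :=
  (LinearIsometry.toLinearIsometryEquiv ⟨f, hf⟩ h).measurePreserving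

/-- The row `i` of the coefficient matrix of a vector of `ℂ^d ⊗ ℂ^k`. -/
def coeffRow {d k : ℕ} (i : Fin d) (ψ : EuclideanSpace ℂ (Fin d × Fin k)) :
    EuclideanSpace ℂ (Fin k) :=
  WithLp.toLp 2 fun a ↦ ψ (i, a)

theorem norm_sq_coeffRow_add (ψ : EuclideanSpace ℂ (Fin 2 × Fin 2)) :
    ‖coeffRow 0 ψ‖ ^ 2 + ‖coeffRow 1 ψ‖ ^ 2 = ‖ψ‖ ^ 2 := by
  simp [EuclideanSpace.norm_sq_eq, coeffRow, Fintype.sum_prod_type]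

theorem measurePreserving_coeffRow :
    MeasurePreserving (fun ψ : EuclideanSpace ℂ (Fin 2 × Fin 2) ↦ (coeffRow 0 ψ, coeffRow 1 ψ))
      volume volume := by
  let f : EuclideanSpace ℂ (Fin 2 × Fin 2) →ₗ[ℝ]
      WithLp 2 (EuclideanSpace ℂ (Fin 2) × EuclideanSpace ℂ (Fin 2)) :=
    { toFun := fun ψ ↦ WithLp.toLp 2 (coeffRow 0 ψ, coeffRow 1 ψ)
      map_add' := fun _ _ ↦ rfl
      map_smul' := fun _ _ ↦ rfl }
  have hf : MeasurePreserving f volume volume := by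
    refine measurePreserving_of_norm_map f (fun ψ ↦ ?_) ?_
    · rw [← sq_eq_sq₀ (norm_nonneg _) (norm_nonneg _), WithLp.prod_norm_sq_eq_of_L2,
        ← norm_sq_coeffRow_add]
      rfl
    · rw [(WithLp.linearEquiv 2 ℝ (EuclideanSpace ℂ (Fin 2) × EuclideanSpace ℂ (Fin 2))).finrank_eq, Module.finrank_prod,
        ← Module.finrank_mul_finrank ℝ ℂ (EuclideanSpace ℂ (Fin 2)),
        ← Module.finrank_mul_finrank ℝ ℂ (EuclideanSpace ℂ (Fin 2 × Fin 2))]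
      simp
  exact (WithLp.volume_preserving_ofLp _ _).comp hf

theorem measurePreserving_complex_pair :
    MeasurePreserving (fun y : EuclideanSpace ℂ (Fin 2) ↦ (y 0, y 1)) volume volume := by
  let f : EuclideanSpace ℂ (Fin 2) →ₗ[ℝ] WithLp 2 (ℂ × ℂ) :=
    { toFun := fun y ↦ WithLp.toLp 2 (y 0, y 1)
      map_add' := fun _ _ ↦ rfl
      map_smul' := fun _ _ ↦ rfl }
  have hf : MeasurePreserving f volume volume := by
    refine measurePreserving_of_norm_map f (fun ψ ↦ ?_) ?_
    · rw [← sq_eq_sq₀ (norm_nonneg _) (norm_nonneg _), WithLp.prod_norm_sq_eq_of_L2,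
        EuclideanSpace.norm_sq_eq, Fin.sum_univ_two]
      rfl
    · rw [(WithLp.linearEquiv 2 ℝ (ℂ × ℂ)).finrank_eq, Module.finrank_prod,
        ← Module.finrank_mul_finrank ℝ ℂ (EuclideanSpace ℂ (Fin 2))]
      simp
  exact (WithLp.volume_preserving_ofLp _ _).comp hf

/-- The coordinates `(r_z, r_x + i r_y)` of a vector `r` of `ℝ³`. -/
noncomputable def axisCoord (r : EuclideanSpace ℝ (Fin 3)) : ℝ × ℂ := (r 2, ⟨r 0, r 1⟩)

theorem norm_sq_eq_axisCoord (r : EuclideanSpace ℝ (Fin 3)) :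
    ‖r‖ ^ 2 = (axisCoord r).1 ^ 2 + ‖(axisCoord r).2‖ ^ 2 := by
  rw [EuclideanSpace.norm_sq_eq, Complex.sq_norm, Complex.normSq_apply]
  simp [axisCoord, Fin.sum_univ_three]
  ring

theorem measurePreserving_axisCoord : MeasurePreserving axisCoord volume volume := by
  let f : EuclideanSpace ℝ (Fin 3) →ₗ[ℝ] WithLp 2 (ℝ × ℂ) :=
    { toFun := fun y ↦ WithLp.toLp 2 (axisCoord y)
      map_add' := fun _ _ ↦ rfl
      map_smul' := fun c x ↦ by
        refine congrArg (WithLp.toLp 2) (Prod.ext rfl ?_)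
        apply Complex.ext <;> simp [axisCoord] }
  have hf : MeasurePreserving f volume volume := by
    refine measurePreserving_of_norm_map f (fun ψ ↦ ?_) ?_
    · rw [← sq_eq_sq₀ (norm_nonneg _) (norm_nonneg _), WithLp.prod_norm_sq_eq_of_L2,
        norm_sq_eq_axisCoord, ← sq_abs (axisCoord ψ).1]
      rfl
    · rw [(WithLp.linearEquiv 2 ℝ (ℝ × ℂ)).finrank_eq, Module.finrank_prod]
      simp
  exact (WithLp.volume_preserving_ofLp _ _).comp hf

/-! ### The joint law of the entries of the reduced matrix -/

/-- For fixed `x ≠ 0`, a unitary change of variables turns `⟪x, y⟫` into `‖x‖` times a coordinate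
of `y`. -/
theorem lintegral_inner_eq {x : EuclideanSpace ℂ (Fin 2)} (hx : x ≠ 0)
    {h : ℝ × ℂ → ENNReal} (hh : Measurable h) :
    ∫⁻ y : EuclideanSpace ℂ (Fin 2), h (‖y‖ ^ 2, inner ℂ x y) =
      ∫⁻ u : ℂ, ∫⁻ v : ℂ, h (‖u‖ ^ 2 + ‖v‖ ^ 2, ‖x‖ * u) := by
  have hn : (‖x‖ : ℂ) ≠ 0 := by simpa using hx
  have hn' : ‖x‖ ≠ 0 := by simpa using hx
  -- the element of `SU(2)` that sends `x` to `‖x‖` times the first basis vector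
  let f : EuclideanSpace ℂ (Fin 2) →ₗ[ℝ] EuclideanSpace ℂ (Fin 2) :=
    { toFun := fun y ↦ WithLp.toLp 2 ![inner ℂ x y / ‖x‖, (x 0 * y 1 - x 1 * y 0) / ‖x‖]
      map_add' := fun y z ↦ by
        ext i
        fin_cases i <;> simp <;> ring
      map_smul' := fun c y ↦ by
        ext i
        fin_cases i <;> simp [inner_smul_right_eq_smul] <;> ring }
  have hnorm : ∀ y, ‖f y‖ = ‖y‖ := by
    intro y
    have key : ‖(inner ℂ x y : ℂ)‖ ^ 2 + ‖x 0 * y 1 - x 1 * y 0‖ ^ 2 = ‖x‖ ^ 2 * ‖y‖ ^ 2 := by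
      simp only [EuclideanSpace.norm_sq_eq, Fin.sum_univ_two, PiLp.inner_apply, Complex.sq_norm,
        RCLike.inner_apply, Complex.normSq_apply, Complex.add_re, Complex.add_im, Complex.sub_re,
        Complex.sub_im, Complex.mul_re, Complex.mul_im, Complex.conj_re, Complex.conj_im]
      ring
    rw [← sq_eq_sq₀ (norm_nonneg _) (norm_nonneg _), EuclideanSpace.norm_sq_eq,
      Fin.sum_univ_two]
    have : ‖(inner ℂ x y : ℂ) / ‖x‖‖ ^ 2 + ‖(x 0 * y 1 - x 1 * y 0) / ‖x‖‖ ^ 2 = ‖y‖ ^ 2 := by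
      rw [norm_div, norm_div, Complex.norm_real, norm_norm, div_pow, div_pow, ← add_div, key]
      field_simp
    exact this
  have hf : MeasurePreserving f volume volume := measurePreserving_of_norm_map f hnorm rfl
  have hg : Measurable fun y : EuclideanSpace ℂ (Fin 2) ↦ h (‖y‖ ^ 2, ‖x‖ * y 0) := by fun_prop
  calc
    ∫⁻ y : EuclideanSpace ℂ (Fin 2), h (‖y‖ ^ 2, inner ℂ x y) =
        ∫⁻ y, h (‖f y‖ ^ 2, ‖x‖ * f y 0) := by
      refine lintegral_congr fun y ↦ ?_
      have h2 : f y 0 = inner ℂ x y / ‖x‖ := rfl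
      rw [hnorm, h2, mul_div_cancel₀ _ hn]
    _ = ∫⁻ y : EuclideanSpace ℂ (Fin 2), h (‖y‖ ^ 2, ‖x‖ * y 0) := hf.lintegral_comp hg
    _ = ∫⁻ y : EuclideanSpace ℂ (Fin 2), h (‖y 0‖ ^ 2 + ‖y 1‖ ^ 2, ‖x‖ * y 0) := by
      simp [EuclideanSpace.norm_sq_eq, Fin.sum_univ_two]
    _ = ∫⁻ p : ℂ × ℂ, h (‖p.1‖ ^ 2 + ‖p.2‖ ^ 2, ‖x‖ * p.1) :=
      measurePreserving_complex_pair.lintegral_comp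
        (f := fun p : ℂ × ℂ ↦ h (‖p.1‖ ^ 2 + ‖p.2‖ ^ 2, ‖x‖ * p.1)) (by fun_prop)
    _ = _ := by
      rw [Measure.volume_eq_prod, lintegral_prod _ (by fun_prop)]

/-- The entries `s = ρ₀₀`, `q = ρ₁₁`, `z = ρ₁₀` of the (unnormalised) reduced matrix of a vector of
`ℂ² ⊗ ℂ²`: the Gram matrix of the two rows of coefficients. -/
noncomputable def gramCoord (ψ : EuclideanSpace ℂ (Fin 2 × Fin 2)) : ℝ × ℝ × ℂ :=
  (‖coeffRow 0 ψ‖ ^ 2, ‖coeffRow 1 ψ‖ ^ 2, inner ℂ (coeffRow 0 ψ) (coeffRow 1 ψ))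

/-- The cone of positive definite matrices, in the coordinates of `gramCoord`. -/
def gramCone : Set (ℝ × ℝ × ℂ) := {p | 0 < p.1 ∧ ‖p.2.2‖ ^ 2 < p.1 * p.2.1}

theorem measurableSet_gramCone : MeasurableSet gramCone := by
  unfold gramCone
  measurability

theorem measurable_gramCoord : Measurable gramCoord := by
  have h (i : Fin 2) : Measurable (coeffRow (d := 2) (k := 2) i) := by
    unfold coeffRow
    fun_prop
  have h0 := h 0
  have h1 := h 1
  unfold gramCoord
  fun_prop

/-- The case of equal dimensions of the complex Wishart density: the Gram matrix of two vectors of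
`ℂ²` pushes Lebesgue measure forward to a multiple of Lebesgue measure on the cone of positive
matrices. -/
theorem exists_lintegral_gramCoord : ∃ c : ENNReal, ∀ G : ℝ × ℝ × ℂ → ENNReal, Measurable G →
    ∫⁻ ψ, G (gramCoord ψ) = c * ∫⁻ p, gramCone.indicator G p := by
  obtain ⟨c₁, hc₁⟩ := exists_lintegral_complex_normSq
  obtain ⟨c₂, hc₂⟩ := exists_lintegral_complex_sq_normSq
  refine ⟨c₂ * c₁, fun G hG ↦ ?_⟩
  have hI : Measurable (gramCone.indicator G) := hG.indicator measurableSet_gramCone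
  -- the contribution of a fixed value of `s`
  set K : ℝ → ENNReal := fun s ↦ ∫⁻ z : ℂ, ∫⁻ q : ℝ, gramCone.indicator G (s, q, z) with hK
  have hKm : Measurable K := by
    refine Measurable.lintegral_prod_right' (f := fun p : ℝ × ℂ ↦
      ∫⁻ q : ℝ, gramCone.indicator G (p.1, q, p.2)) ?_
    exact Measurable.lintegral_prod_right' (f := fun p : (ℝ × ℂ) × ℝ ↦
      gramCone.indicator G (p.1.1, p.2, p.1.2)) (by fun_prop)
  have hin : ∀ s, Measurable fun z : ℂ ↦ ∫⁻ q : ℝ, gramCone.indicator G (s, q, z) := fun s ↦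
    Measurable.lintegral_prod_right' (f := fun p : ℂ × ℝ ↦ gramCone.indicator G (s, p.2, p.1))
      (by fun_prop)
  have hfix : ∀ x : EuclideanSpace ℂ (Fin 2), x ≠ 0 →
      ∫⁻ y : EuclideanSpace ℂ (Fin 2), G (‖x‖ ^ 2, ‖y‖ ^ 2, inner ℂ x y) =
        c₁ * (ENNReal.ofReal ((‖x‖ ^ 2)⁻¹) * K (‖x‖ ^ 2)) := by
    intro x hx
    have hn : ‖x‖ ≠ 0 := by simpa using hx
    have hs : 0 < ‖x‖ ^ 2 := by positivity
    rw [lintegral_inner_eq (h := fun p ↦ G (‖x‖ ^ 2, p.1, p.2)) hx (by fun_prop)]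
    have hv : ∀ u : ℂ, ∫⁻ v : ℂ, G (‖x‖ ^ 2, ‖u‖ ^ 2 + ‖v‖ ^ 2, ‖x‖ * u) =
        c₁ * ∫⁻ q : ℝ, gramCone.indicator G (‖x‖ ^ 2, q, ‖x‖ • u + 0) := by
      intro u
      rw [hc₁ (fun t ↦ G (‖x‖ ^ 2, ‖u‖ ^ 2 + t, ‖x‖ * u)) (by fun_prop),
        ← lintegral_indicator measurableSet_Ioi,
        ← lintegral_add_right_eq_self (fun q ↦ gramCone.indicator G _) (‖u‖ ^ 2)]
      congr 1
      refine lintegral_congr fun t ↦ ?_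
      have hmem : (‖x‖ ^ 2, t + ‖u‖ ^ 2, ‖x‖ • u + 0) ∈ gramCone ↔ t ∈ Ioi (0 : ℝ) := by
        simp only [gramCone, mem_ofPred_eq, add_zero, norm_smul, norm_norm, mem_Ioi, mul_pow, hs,
          true_and]
        rw [mul_lt_mul_iff_right₀ hs]
        simp
      by_cases ht : t ∈ Ioi (0 : ℝ)
      · rw [indicator_of_mem ht, indicator_of_mem (hmem.2 ht)]
        simp [add_comm]
      · rw [indicator_of_notMem ht, indicator_of_notMem (fun h ↦ ht (hmem.1 h))]
    simp_rw [hv]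
    rw [lintegral_const_mul _ ?_]
    · congr 1
      have := lintegral_comp_smul_add (volume : Measure ℂ)
        (f := fun z ↦ ∫⁻ q : ℝ, gramCone.indicator G (‖x‖ ^ 2, q, z)) (hin (‖x‖ ^ 2)) hn 0
      rw [hK]
      simp only
      rw [← this, Complex.finrank_real_complex, ← mul_assoc, ← ENNReal.ofReal_mul (by positivity),
        abs_norm, inv_mul_cancel₀ (by positivity)]
      simp
    · exact (hin (‖x‖ ^ 2)).comp (by fun_prop : Measurable fun u : ℂ ↦ ‖x‖ • u + 0)
  calc
    ∫⁻ ψ, G (gramCoord ψ) = ∫⁻ p : EuclideanSpace ℂ (Fin 2) × EuclideanSpace ℂ (Fin 2),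
        G (‖p.1‖ ^ 2, ‖p.2‖ ^ 2, inner ℂ p.1 p.2) :=
      measurePreserving_coeffRow.lintegral_comp
        (f := fun p : EuclideanSpace ℂ (Fin 2) × EuclideanSpace ℂ (Fin 2) ↦
          G (‖p.1‖ ^ 2, ‖p.2‖ ^ 2, inner ℂ p.1 p.2)) (by fun_prop)
    _ = ∫⁻ x : EuclideanSpace ℂ (Fin 2), ∫⁻ y : EuclideanSpace ℂ (Fin 2),
        G (‖x‖ ^ 2, ‖y‖ ^ 2, inner ℂ x y) := by
      rw [Measure.volume_eq_prod, lintegral_prod _ (by fun_prop)]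
    _ = ∫⁻ x : EuclideanSpace ℂ (Fin 2),
        c₁ * (ENNReal.ofReal ((‖x‖ ^ 2)⁻¹) * K (‖x‖ ^ 2)) := by
      refine lintegral_congr_ae ?_
      filter_upwards [compl_mem_ae_iff.2 (measure_singleton (0 : EuclideanSpace ℂ (Fin 2)))]
        with x hx using hfix x hx
    _ = c₂ * c₁ * ∫⁻ s in Ioi (0 : ℝ), K s := by
      rw [hc₂ (fun s ↦ c₁ * (ENNReal.ofReal s⁻¹ * K s)) (by fun_prop), mul_assoc,
        ← lintegral_const_mul c₁ hKm]
      congr 1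
      refine setLIntegral_congr_fun measurableSet_Ioi fun s hs ↦ ?_
      have hs : (0 : ℝ) < s := hs
      rw [mul_left_comm, ← mul_assoc (ENNReal.ofReal s), ← ENNReal.ofReal_mul hs.le,
        mul_inv_cancel₀ hs.ne', ENNReal.ofReal_one, one_mul]
    _ = c₂ * c₁ * ∫⁻ s, K s := by
      congr 1
      refine setLIntegral_eq_of_support_subset (Function.support_subset_iff'.2 fun s hs ↦ ?_)
      have : ∀ z q, gramCone.indicator G (s, q, z) = 0 := fun z q ↦
        indicator_of_notMem (fun h ↦ hs h.1) _
      simp [hK, this]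
    _ = _ := by
      congr 1
      rw [Measure.volume_eq_prod, lintegral_prod _ hI.aemeasurable]
      refine lintegral_congr fun s ↦ ?_
      rw [Measure.volume_eq_prod, lintegral_prod_symm' _ (by fun_prop)]

/-! ### Normalisation: the uniform law on the Bloch ball -/

/-- The coordinates `(r_z, r_x + i r_y)` of the Bloch vector of the matrix with
coordinates `p`, after division by the trace. -/
noncomputable def normalizedBloch (p : ℝ × ℝ × ℂ) : ℝ × ℂ :=
  (p.1 + p.2.1)⁻¹ • (p.1 - p.2.1, 2 * p.2.2)

/-- The open unit ball of `ℝ × ℂ` for the Euclidean norm. -/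
def euclideanBall : Set (ℝ × ℂ) := {p | p.1 ^ 2 + ‖p.2‖ ^ 2 < 1}

theorem measurableSet_euclideanBall : MeasurableSet euclideanBall := by
  unfold euclideanBall
  measurability

theorem measurable_normalizedBloch : Measurable normalizedBloch := by
  unfold normalizedBloch
  fun_prop

theorem axisCoord_mem_euclideanBall {r : EuclideanSpace ℝ (Fin 3)} :
    axisCoord r ∈ euclideanBall ↔ r ∈ Metric.ball (0 : EuclideanSpace ℝ (Fin 3)) 1 := by
  rw [mem_ball_zero_iff, ← sq_lt_one_iff₀ (norm_nonneg r), norm_sq_eq_axisCoord]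
  rfl

/-- The section of the cone at trace `t` is a ball of radius proportional to `t`, on which
Lebesgue measure is uniform. -/
theorem exists_lintegral_gramCone : ∃ c : ENNReal, ∀ f : ℝ × ℂ → ENNReal, Measurable f →
    ∫⁻ p, gramCone.indicator ({p | p.1 + p.2.1 < 1}.indicator (f ∘ normalizedBloch)) p =
      c * ∫⁻ p in euclideanBall, f p := by
  refine ⟨∫⁻ t in Ioo (0 : ℝ) 1, ENNReal.ofReal (|t / 2| ^ Module.finrank ℝ (ℝ × ℂ)),
    fun f hf ↦ ?_⟩
  have hT : MeasurableSet {p : ℝ × ℝ × ℂ | p.1 + p.2.1 < 1} := by measurability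
  have : (volume : Measure (ℝ × ℂ)).IsAddHaarMeasure :=
    Measure.prod.instIsAddHaarMeasure (volume : Measure ℝ) (volume : Measure ℂ)
  set H : ℝ × ℝ × ℂ → ENNReal :=
    gramCone.indicator ({p | p.1 + p.2.1 < 1}.indicator (f ∘ normalizedBloch)) with hHdef
  have hH : Measurable H :=
    ((hf.comp measurable_normalizedBloch).indicator hT).indicator measurableSet_gramCone
  -- the slice at trace `t`, in the coordinates `(s, z)`
  have hslice : ∀ t : ℝ, ∫⁻ p : ℝ × ℂ, H (p.1, t - p.1, p.2) =
      (Ioo (0 : ℝ) 1).indicator (fun t ↦ ENNReal.ofReal (|t / 2| ^ Module.finrank ℝ (ℝ × ℂ)) *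
        ∫⁻ p in euclideanBall, f p) t := by
    intro t
    by_cases ht : t ∈ Ioo (0 : ℝ) 1
    · have ht0 : 0 < t := ht.1
      rw [indicator_of_mem ht, ← lintegral_comp_smul_add volume
        (f := fun p : ℝ × ℂ ↦ H (p.1, t - p.1, p.2)) (by fun_prop) (half_pos ht0).ne' (t / 2, 0),
        ← lintegral_indicator measurableSet_euclideanBall]
      congr 1
      refine lintegral_congr fun p ↦ ?_
      obtain ⟨m, ζ⟩ := p
      have hp : ((t / 2) • (m, ζ) + (t / 2, (0 : ℂ))) = (t / 2 * (m + 1), (t / 2) • ζ) := by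
        ext <;> simp
        ring
      rw [hp]
      simp only
      have hmem : (t / 2 * (m + 1), t - t / 2 * (m + 1), (t / 2) • ζ) ∈ gramCone ↔
          (m, ζ) ∈ euclideanBall := by
        simp only [gramCone, euclideanBall, mem_ofPred_eq, norm_smul, Real.norm_eq_abs,
          mul_pow, sq_abs]
        have : t / 2 * (m + 1) * (t - t / 2 * (m + 1)) = (t / 2) ^ 2 * (1 - m ^ 2) := by ring
        rw [this, mul_lt_mul_iff_right₀ (by positivity), mul_pos_iff_of_pos_left (by positivity)]
        constructor
        · rintro ⟨-, h⟩
          linarith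
        · intro h
          refine ⟨?_, by linarith⟩
          nlinarith [sq_nonneg ‖ζ‖]
      have hval : normalizedBloch (t / 2 * (m + 1), t - t / 2 * (m + 1), (t / 2) • ζ) = (m, ζ) := by
        have ht' : (t : ℂ) ≠ 0 := by exact_mod_cast ht0.ne'
        ext1
        · simp only [normalizedBloch, Prod.smul_mk, smul_eq_mul]
          field_simp
          ring
        · simp only [normalizedBloch, Prod.smul_mk, Complex.real_smul]
          push_cast
          field_simp
          ring
      rw [hHdef]
      by_cases h : (m, ζ) ∈ euclideanBall
      · rw [indicator_of_mem h, indicator_of_mem (hmem.2 h), indicator_of_mem, Function.comp, hval]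
        simpa using ht.2
      · rw [indicator_of_notMem h, indicator_of_notMem (fun h' ↦ h (hmem.1 h'))]
    · rw [indicator_of_notMem ht]
      have : ∀ p : ℝ × ℂ, H (p.1, t - p.1, p.2) = 0 := by
        rintro ⟨s, z⟩
        by_contra hne
        have h1 := mem_of_indicator_ne_zero hne
        have h2 : s + (t - s) < 1 := by
          rw [hHdef, indicator_of_mem h1] at hne
          exact (mem_of_indicator_ne_zero hne :)
        obtain ⟨h0, h1⟩ := h1
        have h3 : 0 < s * (t - s) := (sq_nonneg _).trans_lt h1
        have h4 := (mul_pos_iff_of_pos_left h0).1 h3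
        simp only at h0
        exact ht ⟨by linarith, by linarith⟩
      simp [this]
  calc
    ∫⁻ p, H p = ∫⁻ s : ℝ, ∫⁻ p : ℝ × ℂ, H (s, p) := by
      rw [Measure.volume_eq_prod, lintegral_prod _ hH.aemeasurable]
    _ = ∫⁻ s : ℝ, ∫⁻ t : ℝ, ∫⁻ z : ℂ, H (s, t - s, z) := by
      refine lintegral_congr fun s ↦ ?_
      rw [Measure.volume_eq_prod, lintegral_prod _ (by fun_prop),
        ← lintegral_sub_right_eq_self _ s]
    _ = ∫⁻ t : ℝ, ∫⁻ s : ℝ, ∫⁻ z : ℂ, H (s, t - s, z) := by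
      refine lintegral_lintegral_swap (Measurable.aemeasurable ?_)
      exact Measurable.lintegral_prod_right' (f := fun p : (ℝ × ℝ) × ℂ ↦
        H (p.1.1, p.1.2 - p.1.1, p.2)) (by fun_prop)
    _ = ∫⁻ t : ℝ, ∫⁻ p : ℝ × ℂ, H (p.1, t - p.1, p.2) := by
      refine lintegral_congr fun t ↦ ?_
      rw [Measure.volume_eq_prod, lintegral_prod _ (by fun_prop)]
    _ = _ := by
      simp_rw [hslice]
      rw [lintegral_indicator measurableSet_Ioo, lintegral_mul_const _ (by fun_prop)]

/-- The normalised uniform measure on the open unit ball of `ℝ³`. -/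
noncomputable def uniformBall : Measure (EuclideanSpace ℝ (Fin 3)) :=
  (volume (Metric.ball (0 : EuclideanSpace ℝ (Fin 3)) 1))⁻¹ •
    volume.restrict (Metric.ball (0 : EuclideanSpace ℝ (Fin 3)) 1)

theorem normalizedBloch_gramCoord_smul {t : ℝ} (ht : t ≠ 0)
    (ψ : EuclideanSpace ℂ (Fin 2 × Fin 2)) :
    normalizedBloch (gramCoord (t • ψ)) = normalizedBloch (gramCoord ψ) := by
  have h (i : Fin 2) : coeffRow i (t • ψ) = (t : ℂ) • coeffRow i ψ := by
    ext a
    simp [coeffRow]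
  have ht' : (t : ℂ) ≠ 0 := by exact_mod_cast ht
  simp only [gramCoord, h, normalizedBloch, norm_smul, inner_smul_left, inner_smul_right,
    Complex.norm_real, Real.norm_eq_abs, mul_pow, sq_abs, Complex.conj_ofReal, ← mul_add,
    ← mul_sub, Prod.smul_mk, smul_eq_mul, mul_inv, Complex.real_smul]
  ext1
  · simp only
    field_simp
  · simp only
    push_cast
    field_simp

theorem axisCoord_blochVector_partialTraceRight
    (ψ : Metric.sphere (0 : EuclideanSpace ℂ (Fin 2 × Fin 2)) 1) :
    axisCoord (blochVector (partialTraceRight (pureDensity ψ.1))) =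
      normalizedBloch (gramCoord ψ.1) := by
  have h1 := norm_sq_coeffRow_add ψ.1
  rw [norm_eq_of_mem_sphere ψ, one_pow] at h1
  simp only [normalizedBloch, gramCoord, h1, inv_one, one_smul]
  ext1
  · simp [axisCoord, blochVector, partialTraceRight, pureDensity, pauli, Matrix.trace,
      Matrix.mul_apply, coeffRow, EuclideanSpace.norm_sq_eq, Complex.sq_norm, Complex.normSq_apply,
      Fin.sum_univ_two]
    ring
  · apply Complex.ext
    all_goals
      simp [axisCoord, blochVector, partialTraceRight, pureDensity, pauli, Matrix.trace,
        Matrix.mul_apply, coeffRow, PiLp.inner_apply, Fin.sum_univ_two]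
      ring

theorem measurable_blochVector : Measurable blochVector := by
  have h (i j : Fin 2) : Measurable fun M : Matrix (Fin 2) (Fin 2) ℂ ↦ M i j :=
    (measurable_pi_apply j).comp (measurable_pi_apply i)
  have h00 := h 0 0
  have h01 := h 0 1
  have h10 := h 1 0
  have h11 := h 1 1
  unfold blochVector
  refine (MeasurableEquiv.toLp 2 _).measurable.comp (measurable_pi_lambda _ fun i ↦ ?_)
  fin_cases i <;>
  · simp only [Matrix.trace_fin_two, Matrix.mul_apply, Fin.sum_univ_two]
    fun_prop

theorem measurable_partialTraceRight_pureDensity : Measurable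
    fun ψ : EuclideanSpace ℂ (Fin 2 × Fin 2) ↦ partialTraceRight (pureDensity ψ) := by
  refine measurable_pi_lambda _ fun i ↦ measurable_pi_lambda _ fun j ↦ ?_
  simp only [partialTraceRight, pureDensity, Matrix.of_apply]
  fun_prop

open scoped Pointwise in
/-- The reduced states of Haar-distributed vectors of `ℂ² ⊗ ℂ²` have Bloch vectors uniformly
distributed in the unit ball. -/
theorem map_blochVector_stateEnsemble :
    (stateEnsemble 2 2).map blochVector = uniformBall := by
  obtain ⟨c₁, hc₁⟩ := exists_lintegral_gramCoord
  obtain ⟨c₂, hc₂⟩ := exists_lintegral_gramCone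
  set S : Measure (Metric.sphere (0 : EuclideanSpace ℂ (Fin 2 × Fin 2)) 1) :=
    (volume : Measure (EuclideanSpace ℂ (Fin 2 × Fin 2))).toSphere with hS
  have hbm : Measurable fun ψ : Metric.sphere (0 : EuclideanSpace ℂ (Fin 2 × Fin 2)) 1 ↦
      blochVector (partialTraceRight (pureDensity ψ.1)) :=
    measurable_blochVector.comp
      (measurable_partialTraceRight_pureDensity.comp measurable_subtype_coe)
  -- the law is proportional to Lebesgue measure on the ball; the factor is found afterwards
  obtain ⟨c, hc⟩ : ∃ c : ENNReal, ∀ B : Set (ℝ × ℂ), MeasurableSet B →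
      S {ψ | axisCoord (blochVector (partialTraceRight (pureDensity ψ.1))) ∈ B} =
        c * volume (B ∩ euclideanBall) := by
    refine ⟨Module.finrank ℝ (EuclideanSpace ℂ (Fin 2 × Fin 2)) * (c₁ * c₂), fun B hB ↦ ?_⟩
    have hBm : MeasurableSet {ψ : Metric.sphere (0 : EuclideanSpace ℂ (Fin 2 × Fin 2)) 1 |
        axisCoord (blochVector (partialTraceRight (pureDensity ψ.1))) ∈ B} :=
      (measurePreserving_axisCoord.measurable.comp hbm) hB
    rw [hS, Measure.toSphere_apply' _ hBm, mul_assoc]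
    congr 1
    -- `toSphere` measures a set through the cone over it, truncated by the unit ball
    set C : Set (EuclideanSpace ℂ (Fin 2 × Fin 2)) :=
      {ψ | normalizedBloch (gramCoord ψ) ∈ B} ∩ Metric.ball 0 1 with hC
    have hCm : MeasurableSet C :=
      ((measurable_normalizedBloch.comp measurable_gramCoord) hB).inter measurableSet_ball
    have hset : Ioo (0 : ℝ) 1 • (Subtype.val ''
        {ψ : Metric.sphere (0 : EuclideanSpace ℂ (Fin 2 × Fin 2)) 1 |
          axisCoord (blochVector (partialTraceRight (pureDensity ψ.1))) ∈ B}) = C \ {0} := by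
      ext φ
      simp only [Set.mem_smul, mem_image, mem_ofPred_eq, Set.mem_sdiff, mem_singleton_iff]
      constructor
      · rintro ⟨t, ht, -, ⟨ψ, hψ, rfl⟩, rfl⟩
        have hn : ‖t • ψ.1‖ = t := by
          rw [norm_smul, norm_eq_of_mem_sphere, mul_one, Real.norm_of_nonneg ht.1.le]
        refine ⟨⟨?_, ?_⟩, ?_⟩
        · rw [axisCoord_blochVector_partialTraceRight] at hψ
          simpa [normalizedBloch_gramCoord_smul ht.1.ne'] using hψ
        · rw [mem_ball_zero_iff, hn]
          exact ht.2
        · rw [← norm_eq_zero, hn]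
          exact ht.1.ne'
      · rintro ⟨⟨h1, h2⟩, h3⟩
        have hn : ‖φ‖ ≠ 0 := by simpa using h3
        refine ⟨‖φ‖, ⟨norm_pos_iff.2 h3, by simpa using h2⟩, ‖φ‖⁻¹ • φ,
          ⟨⟨‖φ‖⁻¹ • φ, by simp [norm_smul, hn]⟩, ?_, rfl⟩, by simp [smul_smul, hn]⟩
        rw [axisCoord_blochVector_partialTraceRight]
        simpa [normalizedBloch_gramCoord_smul (inv_ne_zero hn)] using h1
    have hind : Measurable (B.indicator (1 : ℝ × ℂ → ENNReal)) := measurable_one.indicator hB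
    have hT : MeasurableSet {p : ℝ × ℝ × ℂ | p.1 + p.2.1 < 1} := by measurability
    rw [hset, measure_sdiff_null (measure_singleton _), ← lintegral_indicator_one hCm, mul_assoc]
    have h2 := hc₂ _ hind
    rw [lintegral_indicator_one hB, Measure.restrict_apply hB] at h2
    rw [← h2, ← hc₁ _ ((hind.comp measurable_normalizedBloch).indicator hT)]
    refine lintegral_congr fun ψ ↦ ?_
    have hb : ψ ∈ Metric.ball (0 : EuclideanSpace ℂ (Fin 2 × Fin 2)) 1 ↔
        (gramCoord ψ).1 + (gramCoord ψ).2.1 < 1 := by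
      rw [mem_ball_zero_iff, ← sq_lt_one_iff₀ (norm_nonneg ψ), ← norm_sq_coeffRow_add]
      rfl
    by_cases h : ψ ∈ Metric.ball (0 : EuclideanSpace ℂ (Fin 2 × Fin 2)) 1
    · rw [indicator_of_mem (s := {p : ℝ × ℝ × ℂ | p.1 + p.2.1 < 1}) (hb.1 h), hC,
        inter_indicator_one, Pi.mul_apply, indicator_of_mem h]
      simp [indicator]
    · rw [indicator_of_notMem (s := {p : ℝ × ℝ × ℂ | p.1 + p.2.1 < 1}) (fun h' ↦ h (hb.2 h')),
        indicator_of_notMem (fun h' ↦ h h'.2)]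
  have hc' : ∀ A : Set (EuclideanSpace ℝ (Fin 3)), MeasurableSet A →
      S {ψ | blochVector (partialTraceRight (pureDensity ψ.1)) ∈ A} =
        c * volume (A ∩ Metric.ball 0 1) := by
    intro A hA
    let g : ℝ × ℂ → EuclideanSpace ℝ (Fin 3) := fun p ↦ WithLp.toLp 2 ![p.2.re, p.2.im, p.1]
    have hg : Measurable g := by
      refine (MeasurableEquiv.toLp 2 _).measurable.comp (measurable_pi_lambda _ fun i ↦ ?_)
      fin_cases i
      · exact Complex.measurable_re.comp measurable_snd
      · exact Complex.measurable_im.comp measurable_snd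
      · exact measurable_fst
    have hga : ∀ r, g (axisCoord r) = r := by
      intro r
      ext i
      fin_cases i <;> rfl
    have h := hc (g ⁻¹' A) (hg hA)
    simp only [mem_preimage, hga] at h
    rw [h, ← measurePreserving_axisCoord.measure_preimage
      ((hg hA).inter measurableSet_euclideanBall).nullMeasurableSet]
    congr 2
    ext r
    simp [hga, axisCoord_mem_euclideanBall]
  have hb0 : volume (Metric.ball (0 : EuclideanSpace ℝ (Fin 3)) 1) ≠ 0 :=
    (Metric.measure_ball_pos _ _ one_pos).ne'
  have hbt : volume (Metric.ball (0 : EuclideanSpace ℝ (Fin 3)) 1) ≠ ⊤ :=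
    measure_ball_lt_top.ne
  have huniv : S univ = c * volume (Metric.ball (0 : EuclideanSpace ℝ (Fin 3)) 1) := by
    simpa using hc' univ MeasurableSet.univ
  have hS0 : S univ ≠ 0 := by
    have : S ≠ 0 := Measure.toSphere_ne_zero _
    simpa using this
  have hSt : S univ ≠ ⊤ := measure_ne_top _ _
  have hc0 : c ≠ 0 := by
    rintro rfl
    simp [huniv] at hS0
  have hct : c ≠ ⊤ := by
    rintro rfl
    exact hSt (huniv.trans (ENNReal.top_mul hb0))
  ext A hA
  have hm : Measurable fun ψ : Metric.sphere (0 : EuclideanSpace ℂ (Fin 2 × Fin 2)) 1 ↦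
      partialTraceRight (pureDensity ψ.1) :=
    measurable_partialTraceRight_pureDensity.comp measurable_subtype_coe
  rw [stateEnsemble, Measure.map_map measurable_blochVector hm, haarPureState,
    Measure.map_apply (measurable_blochVector.comp hm) hA, uniformBall, Measure.smul_apply,
    Measure.smul_apply, Measure.restrict_apply hA, smul_eq_mul, smul_eq_mul, ← hS, huniv]
  refine (congrArg _ (hc' A hA)).trans ?_
  rw [ENNReal.mul_inv (Or.inl hc0) (Or.inl hct), mul_mul_mul_comm,
    ENNReal.inv_mul_cancel hc0 hct, one_mul]

/-! ### The volume of the intersection of two balls -/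

theorem volume_complex_normSq_lt (m : ℝ) :
    volume {ζ : ℂ | ‖ζ‖ ^ 2 < m} = ENNReal.ofReal (Real.pi * m) := by
  rcases le_or_gt m 0 with hm | hm
  · have : {ζ : ℂ | ‖ζ‖ ^ 2 < m} = ∅ :=
      eq_empty_of_forall_notMem fun ζ h ↦ (hm.trans (sq_nonneg ‖ζ‖)).not_gt h
    rw [this, measure_empty, ENNReal.ofReal_of_nonpos]
    exact mul_nonpos_of_nonneg_of_nonpos Real.pi_pos.le hm
  · have : {ζ : ℂ | ‖ζ‖ ^ 2 < m} = Metric.ball 0 √m := by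
      ext ζ
      rw [mem_ball_zero_iff, Real.lt_sqrt (norm_nonneg ζ)]
      rfl
    rw [this, Complex.volume_ball, ← ENNReal.ofReal_pow (Real.sqrt_nonneg m), Real.sq_sqrt hm.le,
      ← ENNReal.ofReal_coe_nnreal, NNReal.coe_real_pi, ← ENNReal.ofReal_mul hm.le, mul_comm]

theorem integral_const_sub_sq (c m u v : ℝ) :
    ∫ x in u..v, Real.pi * (m - (x - c) ^ 2) =
      Real.pi * (m * (v - u) - ((v - c) ^ 3 - (u - c) ^ 3) / 3) := by
  have h : ∀ x ∈ uIcc u v, HasDerivAt (fun x ↦ Real.pi * (m * x - (x - c) ^ 3 / 3))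
      (Real.pi * (m - (x - c) ^ 2)) x := by
    intro x _
    have h1 := (((hasDerivAt_id x).sub_const c).pow 3).div_const 3
    have h2 := (((hasDerivAt_id x).const_mul m).sub h1).const_mul Real.pi
    refine h2.congr_deriv ?_
    simp
  rw [intervalIntegral.integral_eq_sub_of_hasDerivAt h
    (Continuous.intervalIntegrable (by fun_prop) _ _)]
  ring

/-- The volume of a spherical lens is rotation invariant, and slicing it orthogonally to the axis
through the centres gives disks. -/
theorem volume_ball_inter_ball_eq_lintegral (a b : ℝ) (ha : 0 ≤ a) (hb : 0 ≤ b)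
    (X : EuclideanSpace ℝ (Fin 3)) :
    volume (Metric.ball (0 : EuclideanSpace ℝ (Fin 3)) a ∩ Metric.ball X b) =
      ∫⁻ x : ℝ, ENNReal.ofReal (Real.pi * min (a ^ 2 - x ^ 2) (b ^ 2 - (x - ‖X‖) ^ 2)) := by
  set Y : EuclideanSpace ℝ (Fin 3) := EuclideanSpace.single 2 ‖X‖ with hY
  have hXY : ‖X‖ = ‖Y‖ := by rw [hY, PiLp.norm_single, norm_norm]
  set R := (Submodule.span ℝ {X - Y})ᗮ.reflection with hR
  have hRX : R X = Y := Submodule.reflection_sub hXY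
  set D : Set (ℝ × ℂ) :=
    {p | ‖p.2‖ ^ 2 < min (a ^ 2 - p.1 ^ 2) (b ^ 2 - (p.1 - ‖X‖) ^ 2)} with hD
  have hDm : MeasurableSet D :=
    measurableSet_lt (f := fun p : ℝ × ℂ ↦ ‖p.2‖ ^ 2)
      (g := fun p : ℝ × ℂ ↦ min (a ^ 2 - p.1 ^ 2) (b ^ 2 - (p.1 - ‖X‖) ^ 2))
      (by fun_prop) (by fun_prop)
  have h1 : Metric.ball (0 : EuclideanSpace ℝ (Fin 3)) a ∩ Metric.ball X b =
      R ⁻¹' (Metric.ball 0 a ∩ Metric.ball Y b) := by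
    rw [← hRX]
    ext v
    simp only [mem_preimage, mem_inter_iff, R.norm_map, mem_ball_iff_norm, sub_zero,
      ← map_sub]
  have h2 : Metric.ball (0 : EuclideanSpace ℝ (Fin 3)) a ∩ Metric.ball Y b = axisCoord ⁻¹' D := by
    ext v
    have hv : (axisCoord (v - Y)).1 = (axisCoord v).1 - ‖X‖ ∧
        (axisCoord (v - Y)).2 = (axisCoord v).2 := by
      simp [axisCoord, hY]
    rw [mem_inter_iff, mem_ball_zero_iff, mem_ball_iff_norm, ← sq_lt_sq₀ (norm_nonneg _) ha,
      ← sq_lt_sq₀ (norm_nonneg _) hb, norm_sq_eq_axisCoord, norm_sq_eq_axisCoord, hv.1, hv.2,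
      mem_preimage, hD, mem_ofPred_eq, lt_min_iff, lt_sub_iff_add_lt', lt_sub_iff_add_lt']
  rw [h1, R.measurePreserving.measure_preimage
    (measurableSet_ball.inter measurableSet_ball).nullMeasurableSet, h2,
    measurePreserving_axisCoord.measure_preimage hDm.nullMeasurableSet, Measure.volume_eq_prod,
    Measure.prod_apply hDm]
  exact lintegral_congr fun x ↦ volume_complex_normSq_lt
    (min (a ^ 2 - x ^ 2) (b ^ 2 - (x - ‖X‖) ^ 2))

/-- The volume of a spherical lens, for radii `b ≤ a` and partially overlapping balls. -/
theorem volume_ball_inter_ball {a b : ℝ} (hb : 0 ≤ b) (hba : b ≤ a)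
    (X : EuclideanSpace ℝ (Fin 3)) (hX : 0 < ‖X‖) (h1 : a - b ≤ ‖X‖) (h2 : ‖X‖ ≤ a + b) :
    volume (Metric.ball (0 : EuclideanSpace ℝ (Fin 3)) a ∩ Metric.ball X b) =
      ENNReal.ofReal (Real.pi * (a + b - ‖X‖) ^ 2 *
        (‖X‖ ^ 2 + 2 * (a + b) * ‖X‖ - 3 * (a - b) ^ 2) / (12 * ‖X‖)) := by
  rw [volume_ball_inter_ball_eq_lintegral a b (hb.trans hba) hb]
  set r := ‖X‖
  -- the plane `x = x₀` contains the circle where the two spheres meet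
  set x₀ := (r ^ 2 + a ^ 2 - b ^ 2) / (2 * r) with hx₀
  have hx : 2 * r * x₀ = r ^ 2 + a ^ 2 - b ^ 2 := by
    rw [hx₀]
    field_simp
  have hlow : r - b ≤ x₀ := by
    rw [hx₀, le_div_iff₀ (by positivity)]
    nlinarith [mul_nonneg (sub_nonneg.2 h1) (sub_nonneg.2 h2)]
  have hup : x₀ ≤ a := by
    rw [hx₀, div_le_iff₀ (by positivity)]
    nlinarith [mul_nonneg (sub_nonneg.2 h1) (sub_nonneg.2 h2)]
  -- `ENNReal.ofReal` vanishes on the planes that miss the lens, where the minimum is not positive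
  have hpt : ∀ x : ℝ, ENNReal.ofReal (Real.pi * min (a ^ 2 - x ^ 2) (b ^ 2 - (x - r) ^ 2)) =
      (Ioc (r - b) x₀).indicator
        (fun x ↦ ENNReal.ofReal (Real.pi * (b ^ 2 - (x - r) ^ 2))) x +
      (Ioc x₀ a).indicator (fun x ↦ ENNReal.ofReal (Real.pi * (a ^ 2 - (x - 0) ^ 2))) x := by
    intro x
    rcases le_or_gt x (r - b) with hxl | hxl
    · rw [indicator_of_notMem (fun h ↦ h.1.not_ge hxl),
        indicator_of_notMem (fun h ↦ h.1.not_ge (hxl.trans hlow)), add_zero,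
        ENNReal.ofReal_of_nonpos]
      refine mul_nonpos_of_nonneg_of_nonpos Real.pi_pos.le ((min_le_right _ _).trans ?_)
      nlinarith
    rcases le_or_gt x x₀ with hxm | hxm
    · rw [indicator_of_mem (show x ∈ Ioc (r - b) x₀ from ⟨hxl, hxm⟩),
        indicator_of_notMem (fun h ↦ h.1.not_ge hxm), add_zero, min_eq_right]
      nlinarith [mul_le_mul_of_nonneg_left hxm hX.le]
    rcases le_or_gt x a with hxu | hxu
    · rw [indicator_of_notMem (fun h ↦ h.2.not_gt hxm),
        indicator_of_mem (show x ∈ Ioc x₀ a from ⟨hxm, hxu⟩), zero_add, min_eq_left, sub_zero]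
      nlinarith [mul_le_mul_of_nonneg_left hxm.le hX.le]
    · rw [indicator_of_notMem (fun h ↦ h.2.not_gt hxm),
        indicator_of_notMem (fun h ↦ h.2.not_gt hxu), add_zero, ENNReal.ofReal_of_nonpos]
      refine mul_nonpos_of_nonneg_of_nonpos Real.pi_pos.le ((min_le_left _ _).trans ?_)
      nlinarith
  have hint : ∀ (c m u v : ℝ), u ≤ v → (∀ x ∈ Ioc u v, 0 ≤ m - (x - c) ^ 2) →
      ∫⁻ x in Ioc u v, ENNReal.ofReal (Real.pi * (m - (x - c) ^ 2)) =
        ENNReal.ofReal (Real.pi * (m * (v - u) - ((v - c) ^ 3 - (u - c) ^ 3) / 3)) ∧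
      0 ≤ Real.pi * (m * (v - u) - ((v - c) ^ 3 - (u - c) ^ 3) / 3) := by
    intro c m u v huv hpos
    have hnn : ∀ x ∈ Ioc u v, 0 ≤ Real.pi * (m - (x - c) ^ 2) := fun x hx ↦
      mul_nonneg Real.pi_pos.le (hpos x hx)
    rw [← integral_const_sub_sq, intervalIntegral.integral_of_le huv]
    refine ⟨(ofReal_integral_eq_lintegral_ofReal ?_ ?_).symm,
      setIntegral_nonneg measurableSet_Ioc hnn⟩
    · exact (Continuous.integrableOn_Icc (by fun_prop)).mono_set Ioc_subset_Icc_self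
    · exact (ae_restrict_iff' measurableSet_Ioc).2 (ae_of_all _ hnn)
  obtain ⟨hi1, hp1⟩ := hint r (b ^ 2) (r - b) x₀ hlow fun x hx ↦ by
    have : x ≤ r + b := hx.2.trans (by
      rw [hx₀, div_le_iff₀ (by positivity)]
      nlinarith [mul_nonneg (sub_nonneg.2 h1) (sub_nonneg.2 h2)])
    nlinarith [mul_nonneg (sub_nonneg.2 hx.1.le) (sub_nonneg.2 this)]
  obtain ⟨hi2, hp2⟩ := hint 0 (a ^ 2) x₀ a hup fun x hx ↦ by
    have : -a ≤ x := le_trans (by linarith) (hlow.trans hx.1.le)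
    nlinarith [mul_nonneg (sub_nonneg.2 hx.2) (sub_nonneg.2 this)]
  simp_rw [hpt]
  rw [lintegral_add_left (Measurable.indicator (by fun_prop) measurableSet_Ioc),
    lintegral_indicator measurableSet_Ioc, lintegral_indicator measurableSet_Ioc, hi1, hi2,
    ← ENNReal.ofReal_add hp1 hp2]
  congr 1
  rw [hx₀]
  field_simp
  ring

theorem volume_ball_inter_ball_of_add_le {a b : ℝ} (hb : 0 ≤ b) (X : EuclideanSpace ℝ (Fin 3))
    (h : ‖X‖ + b ≤ a) :
    volume (Metric.ball (0 : EuclideanSpace ℝ (Fin 3)) a ∩ Metric.ball X b) =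
      ENNReal.ofReal (Real.pi * 4 / 3 * b ^ 3) := by
  rw [inter_eq_right.2 (Metric.ball_subset_ball' (by rw [dist_zero_right]; linarith)),
    EuclideanSpace.volume_ball_fin_three, ← ENNReal.ofReal_pow hb,
    ← ENNReal.ofReal_mul (by positivity), mul_comm]

theorem volume_ball_inter_ball_of_le {a b : ℝ} (X : EuclideanSpace ℝ (Fin 3))
    (h : a + b ≤ ‖X‖) :
    volume (Metric.ball (0 : EuclideanSpace ℝ (Fin 3)) a ∩ Metric.ball X b) = 0 := by
  rw [(Metric.ball_disjoint_ball (by rw [dist_zero_left]; exact h)).inter_eq, measure_empty]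

/-! ### The density of the length of the mixed Bloch vector -/

/-- The density of the length of the Bloch vector of `w ρ₁ + (1 - w) ρ₂`; the formula is meaningful
for `1 / 2 < w < 1`. -/
noncomputable def mixtureDensity (w r : ℝ) : ℝ :=
  if r ≤ 0 then 0
  else if r ≤ 2 * w - 1 then 3 * r ^ 2 / w ^ 3
  else if r ≤ 1 then
    3 * (1 - r) ^ 2 * r * (r ^ 2 + 2 * r - 12 * w ^ 2 + 12 * w - 3) / (16 * w ^ 3 * (1 - w) ^ 3)
  else 0

section Density

variable {w : ℝ}

theorem mixtureDensity_of_nonpos {r : ℝ} (hr : r ≤ 0) : mixtureDensity w r = 0 := if_pos hr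

theorem mixtureDensity_of_le {r : ℝ} (h0 : 0 ≤ r) (h : r ≤ 2 * w - 1) :
    mixtureDensity w r = 3 * r ^ 2 / w ^ 3 := by
  rcases h0.eq_or_lt with rfl | h0
  · simp [mixtureDensity]
  · rw [mixtureDensity, if_neg h0.not_ge, if_pos h]

theorem mixtureDensity_of_one_lt (hw : w ≤ 1) {r : ℝ} (h : 1 < r) : mixtureDensity w r = 0 := by
  rw [mixtureDensity, if_neg (by linarith), if_neg (by linarith), if_neg (by linarith)]

/-- The two formulas agree at the junction `r = 2 w - 1`. -/
theorem mixtureDensity_junction (hw : w ∈ Ioo (1 / 2 : ℝ) 1) :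
    3 * (2 * w - 1) ^ 2 / w ^ 3 = 3 * (1 - (2 * w - 1)) ^ 2 * (2 * w - 1) *
      ((2 * w - 1) ^ 2 + 2 * (2 * w - 1) - 12 * w ^ 2 + 12 * w - 3) /
        (16 * w ^ 3 * (1 - w) ^ 3) := by
  have h0 : w ≠ 0 := by linarith [hw.1]
  have h1 : 1 - w ≠ 0 := by linarith [hw.2]
  field_simp
  ring

theorem mixtureDensity_of_mem_Icc (hw : w ∈ Ioo (1 / 2 : ℝ) 1) {r : ℝ}
    (hr : r ∈ Icc (2 * w - 1) 1) :
    mixtureDensity w r = 3 * (1 - r) ^ 2 * r * (r ^ 2 + 2 * r - 12 * w ^ 2 + 12 * w - 3) /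
      (16 * w ^ 3 * (1 - w) ^ 3) := by
  rcases hr.1.eq_or_lt with rfl | h
  · rw [mixtureDensity_of_le (by linarith [hw.1]) le_rfl, mixtureDensity_junction hw]
  · rw [mixtureDensity, if_neg (by linarith [hw.1]), if_neg h.not_ge, if_pos hr.2]

theorem mixtureDensity_nonneg (hw : w ∈ Ioo (1 / 2 : ℝ) 1) (r : ℝ) : 0 ≤ mixtureDensity w r := by
  obtain ⟨hw1, hw2⟩ := hw
  have h1 : 0 < 1 - w := by linarith
  rw [mixtureDensity]
  split_ifs with h2 h3 h4
  · exact le_rfl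
  · positivity
  · have : 0 ≤ r ^ 2 + 2 * r - 12 * w ^ 2 + 12 * w - 3 := by nlinarith
    have : 0 < r := by linarith
    positivity
  · exact le_rfl

theorem continuous_mixtureDensity (hw : w ∈ Ioo (1 / 2 : ℝ) 1) :
    Continuous (mixtureDensity w) := by
  have hw' := hw.1
  have hw'' := hw.2
  refine Continuous.if_le continuous_const ?_ continuous_id continuous_const ?_
  · refine Continuous.if_le (by fun_prop) ?_ continuous_id continuous_const ?_
    · refine Continuous.if_le (by fun_prop) continuous_const continuous_id continuous_const ?_
      rintro r rfl
      simp
    · rintro r rfl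
      rw [if_pos (by linarith), mixtureDensity_junction hw]
  · rintro r rfl
    rw [if_pos (by linarith)]
    simp

theorem tendsto_mixtureDensity_one {r : ℝ} (hr : r ∈ Ico (0 : ℝ) 1) :
    Tendsto (fun w ↦ mixtureDensity w r) (𝓝[<] 1) (𝓝 (3 * r ^ 2)) := by
  have hlim : Tendsto (fun w : ℝ ↦ 3 * r ^ 2 / w ^ 3) (𝓝[<] 1) (𝓝 (3 * r ^ 2)) := by
    have : ContinuousAt (fun w : ℝ ↦ 3 * r ^ 2 / w ^ 3) 1 :=
      ContinuousAt.div₀ (by fun_prop) (by fun_prop) (by norm_num)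
    simpa using this.tendsto.mono_left nhdsWithin_le_nhds
  refine hlim.congr' ?_
  have hev : ∀ᶠ w : ℝ in 𝓝 1, (1 + r) / 2 < w := lt_mem_nhds (by linarith [hr.2])
  filter_upwards [nhdsWithin_le_nhds hev] with w hw
  rw [mixtureDensity_of_le hr.1 (by linarith)]

theorem tendsto_mixtureDensity_half {r : ℝ} (hr : r ∈ Icc (0 : ℝ) 1) :
    Tendsto (fun w ↦ mixtureDensity w r) (𝓝[>] (1 / 2))
      (𝓝 (12 * r ^ 2 * (r ^ 3 - 3 * r + 2))) := by
  rcases hr.1.eq_or_lt with rfl | h0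
  · simp [mixtureDensity_of_nonpos]
  have hlim : Tendsto (fun w : ℝ ↦ 3 * (1 - r) ^ 2 * r * (r ^ 2 + 2 * r - 12 * w ^ 2 + 12 * w - 3) /
      (16 * w ^ 3 * (1 - w) ^ 3)) (𝓝[>] (1 / 2)) (𝓝 (12 * r ^ 2 * (r ^ 3 - 3 * r + 2))) := by
    have : ContinuousAt (fun w : ℝ ↦ 3 * (1 - r) ^ 2 * r *
        (r ^ 2 + 2 * r - 12 * w ^ 2 + 12 * w - 3) / (16 * w ^ 3 * (1 - w) ^ 3)) (1 / 2) :=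
      ContinuousAt.div₀ (by fun_prop) (by fun_prop) (by norm_num)
    convert this.tendsto.mono_left nhdsWithin_le_nhds using 2
    norm_num
    ring
  refine hlim.congr' ?_
  have hev : ∀ᶠ w : ℝ in 𝓝 (1 / 2), w < min 1 ((1 + r) / 2) :=
    gt_mem_nhds (lt_min (by norm_num) (by linarith))
  filter_upwards [nhdsWithin_le_nhds hev, self_mem_nhdsWithin] with w hw hw'
  rw [lt_min_iff] at hw
  rw [mixtureDensity_of_mem_Icc ⟨hw', hw.1⟩ ⟨by linarith, hr.2⟩]

/-- Up to a constant, the density at `r` is `r ^ 2` times the volume of the intersection of two balls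
of radii `w` and `1 - w` whose centres are at distance `r`. -/
theorem sq_mul_volume_ball_inter_ball (hw : w ∈ Ioo (1 / 2 : ℝ) 1)
    {X : EuclideanSpace ℝ (Fin 3)} (hX : X ≠ 0) :
    ENNReal.ofReal (‖X‖ ^ 2) *
        volume (Metric.ball (0 : EuclideanSpace ℝ (Fin 3)) w ∩ Metric.ball X (1 - w)) =
      ENNReal.ofReal (4 * Real.pi / 9 * (w ^ 3 * (1 - w) ^ 3)) *
        ENNReal.ofReal (mixtureDensity w ‖X‖) := by
  have hr : 0 < ‖X‖ := norm_pos_iff.2 hX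
  have h0 : 0 < w := by linarith [hw.1]
  have h1 : 0 < 1 - w := by linarith [hw.2]
  have hw' := hw.1
  rw [← ENNReal.ofReal_mul (by positivity)]
  rcases le_or_gt ‖X‖ (2 * w - 1) with hl | hl
  · rw [volume_ball_inter_ball_of_add_le h1.le X (by linarith), mixtureDensity_of_le hr.le hl,
      ← ENNReal.ofReal_mul (by positivity)]
    congr 1
    field_simp
    ring
  rcases le_or_gt ‖X‖ 1 with hu | hu
  · rw [volume_ball_inter_ball h1.le (by linarith) X hr (by linarith) (by linarith),
      mixtureDensity_of_mem_Icc hw ⟨hl.le, hu⟩, ← ENNReal.ofReal_mul (by positivity)]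
    congr 1
    field_simp
    ring
  · rw [volume_ball_inter_ball_of_le X (by linarith), mixtureDensity_of_one_lt hw.2.le hu]
    simp

/-- The law of the length of `w x + (1 - w) y`, for independent uniform points `x` and `y` of the
unit ball of `ℝ³`. -/
theorem lintegral_norm_uniformBall_mixture (hw : w ∈ Ioo (1 / 2 : ℝ) 1) {f : ℝ → ENNReal}
    (hf : Measurable f) :
    ∫⁻ x, ∫⁻ y, f ‖w • x + (1 - w) • y‖ ∂uniformBall ∂uniformBall =
      ∫⁻ r, f r * ENNReal.ofReal (mixtureDensity w r) := by
  have h0 : 0 < w := by linarith [hw.1]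
  have h1 : 0 < 1 - w := by linarith [hw.2]
  have hpm : Measurable (mixtureDensity w) := (continuous_mixtureDensity hw).measurable
  set B : Set (EuclideanSpace ℝ (Fin 3)) := Metric.ball 0 1 with hB
  have hdist : MeasurableSet {p : EuclideanSpace ℝ (Fin 3) × EuclideanSpace ℝ (Fin 3) |
      p.2 ∈ Metric.ball p.1 (1 - w)} :=
    measurableSet_lt (f := fun p : EuclideanSpace ℝ (Fin 3) × EuclideanSpace ℝ (Fin 3) ↦
      dist p.2 p.1) (g := fun _ ↦ 1 - w) (by fun_prop) (by fun_prop)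
  have hFm : Measurable fun p : EuclideanSpace ℝ (Fin 3) × EuclideanSpace ℝ (Fin 3) ↦
      (Metric.ball p.1 (1 - w)).indicator (fun X ↦ f ‖X‖) p.2 :=
    (show Measurable fun p : EuclideanSpace ℝ (Fin 3) × EuclideanSpace ℝ (Fin 3) ↦ f ‖p.2‖
      by fun_prop).indicator hdist
  set K : EuclideanSpace ℝ (Fin 3) → ENNReal := fun Y ↦
    ∫⁻ X, (Metric.ball Y (1 - w)).indicator (fun X ↦ f ‖X‖) X with hK
  have hKm : Measurable K := hFm.lintegral_prod_right'
  have hrest (Y : EuclideanSpace ℝ (Fin 3)) :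
      ENNReal.ofReal ((1 - w) ^ 3) * ∫⁻ y in B, f ‖Y + (1 - w) • y‖ = K Y := by
    rw [hK]
    simp only
    rw [← lintegral_comp_smul_add volume
      ((show Measurable fun X : EuclideanSpace ℝ (Fin 3) ↦ f ‖X‖ by fun_prop).indicator
        measurableSet_ball) h1.ne' Y, ← lintegral_indicator measurableSet_ball, abs_of_pos h1,
      finrank_euclideanSpace_fin]
    congr 1
    refine lintegral_congr fun y ↦ ?_
    have hmem : (1 - w) • y + Y ∈ Metric.ball Y (1 - w) ↔ y ∈ B := by
      rw [hB, mem_ball_zero_iff, mem_ball_iff_norm, add_sub_cancel_right, norm_smul,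
        Real.norm_of_nonneg h1.le]
      exact mul_lt_iff_lt_one_right h1
    by_cases hy : y ∈ B
    · rw [indicator_of_mem hy, indicator_of_mem (hmem.2 hy), add_comm]
    · rw [indicator_of_notMem hy, indicator_of_notMem (fun h ↦ hy (hmem.1 h))]
  have hfst : ENNReal.ofReal (w ^ 3) * ∫⁻ x in B, K (w • x) = ∫⁻ Y in Metric.ball 0 w, K Y := by
    rw [← lintegral_indicator measurableSet_ball, ← lintegral_indicator measurableSet_ball,
      ← lintegral_comp_smul_add volume (hKm.indicator measurableSet_ball) h0.ne' 0,
      abs_of_pos h0, finrank_euclideanSpace_fin]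
    congr 1
    refine lintegral_congr fun y ↦ ?_
    have hmem : w • y + 0 ∈ Metric.ball (0 : EuclideanSpace ℝ (Fin 3)) w ↔ y ∈ B := by
      rw [hB, mem_ball_zero_iff, mem_ball_zero_iff, add_zero, norm_smul,
        Real.norm_of_nonneg h0.le]
      exact mul_lt_iff_lt_one_right h0
    by_cases hy : y ∈ B
    · rw [indicator_of_mem hy, indicator_of_mem (hmem.2 hy), add_zero]
    · rw [indicator_of_notMem hy, indicator_of_notMem (fun h ↦ hy (hmem.1 h))]
  have hswap : ∫⁻ Y in Metric.ball 0 w, K Y =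
      ∫⁻ X : EuclideanSpace ℝ (Fin 3), f ‖X‖ *
        volume (Metric.ball (0 : EuclideanSpace ℝ (Fin 3)) w ∩ Metric.ball X (1 - w)) := by
    rw [hK, lintegral_lintegral_swap hFm.aemeasurable]
    refine lintegral_congr fun X ↦ ?_
    have : ∀ Y, (Metric.ball Y (1 - w)).indicator (fun X ↦ f ‖X‖) X =
        (Metric.ball X (1 - w)).indicator (fun _ ↦ f ‖X‖) Y := by
      intro Y
      simp only [indicator, Metric.mem_ball, dist_comm]
    simp_rw [this]
    rw [lintegral_indicator measurableSet_ball, lintegral_const,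
      Measure.restrict_restrict measurableSet_ball, Measure.restrict_apply_univ, inter_comm]
  have hpolar : ∫⁻ X : EuclideanSpace ℝ (Fin 3), f ‖X‖ *
        volume (Metric.ball (0 : EuclideanSpace ℝ (Fin 3)) w ∩ Metric.ball X (1 - w)) =
      3 * volume B * (ENNReal.ofReal (4 * Real.pi / 9 * (w ^ 3 * (1 - w) ^ 3)) *
        ∫⁻ r, f r * ENNReal.ofReal (mixtureDensity w r)) := by
    set C := ENNReal.ofReal (4 * Real.pi / 9 * (w ^ 3 * (1 - w) ^ 3)) with hC
    have hfin : Module.finrank ℝ (EuclideanSpace ℝ (Fin 3)) - 1 = 2 := by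
      rw [finrank_euclideanSpace_fin]
    have hlens : ∀ X : EuclideanSpace ℝ (Fin 3), X ≠ 0 → f ‖X‖ *
        volume (Metric.ball (0 : EuclideanSpace ℝ (Fin 3)) w ∩ Metric.ball X (1 - w)) =
        (ENNReal.ofReal (‖X‖ ^ 2))⁻¹ * (C * (f ‖X‖ * ENNReal.ofReal (mixtureDensity w ‖X‖))) := by
      intro X hX
      have hX2 : ENNReal.ofReal (‖X‖ ^ 2) ≠ 0 := by simpa using hX
      rw [mul_left_comm C, ← sq_mul_volume_ball_inter_ball hw hX, mul_left_comm (f ‖X‖),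
        ← mul_assoc _ (ENNReal.ofReal (‖X‖ ^ 2)), ENNReal.inv_mul_cancel hX2 ENNReal.ofReal_ne_top,
        one_mul]
    calc
      _ = ∫⁻ X : EuclideanSpace ℝ (Fin 3), (ENNReal.ofReal (‖X‖ ^ 2))⁻¹ *
          (C * (f ‖X‖ * ENNReal.ofReal (mixtureDensity w ‖X‖))) := by
        refine lintegral_congr_ae ?_
        filter_upwards [compl_mem_ae_iff.2 (measure_singleton (0 : EuclideanSpace ℝ (Fin 3)))]
          with X hX using hlens X hX
      _ = 3 * volume B * ∫⁻ r in Ioi (0 : ℝ),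
          C * (f r * ENNReal.ofReal (mixtureDensity w r)) := by
        rw [lintegral_fun_norm_eq (f := fun r ↦ (ENNReal.ofReal (r ^ 2))⁻¹ *
          (C * (f r * ENNReal.ofReal (mixtureDensity w r)))) volume (by fun_prop),
          Measure.toSphere_apply_univ, finrank_euclideanSpace_fin]
        congr 1
        refine setLIntegral_congr_fun measurableSet_Ioi fun r hr ↦ ?_
        have hr2 : ENNReal.ofReal (r ^ 2) ≠ 0 := by
          have := pow_pos (mem_Ioi.1 hr) 2
          simpa using this.ne'
        simp only [Nat.add_one_sub_one]
        rw [← mul_assoc, ENNReal.mul_inv_cancel hr2 ENNReal.ofReal_ne_top, one_mul]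
      _ = _ := by
        rw [lintegral_const_mul _ (by fun_prop), setLIntegral_eq_of_support_subset]
        refine Function.support_subset_iff'.2 fun r hr ↦ ?_
        rw [mixtureDensity_of_nonpos (not_lt.1 hr), ENNReal.ofReal_zero, mul_zero]
  have hV : volume B = ENNReal.ofReal (4 * Real.pi / 3) := by
    rw [hB, EuclideanSpace.volume_ball_fin_three, ENNReal.ofReal_one, one_pow, one_mul, mul_comm]
  have hV' : 3 * ENNReal.ofReal (4 * Real.pi / 9) = volume B := by
    rw [hV, ← ENNReal.ofReal_ofNat, ← ENNReal.ofReal_mul (by norm_num)]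
    congr 1
    ring
  have hV0 : volume B ≠ 0 := (Metric.measure_ball_pos _ _ one_pos).ne'
  have hVt : volume B ≠ ⊤ := measure_ball_lt_top.ne
  set I := ∫⁻ r, f r * ENNReal.ofReal (mixtureDensity w r)
  have hJ : ∫⁻ x in B, ∫⁻ y in B, f ‖w • x + (1 - w) • y‖ = volume B * volume B * I := by
    have hA0 : ENNReal.ofReal (w ^ 3 * (1 - w) ^ 3) ≠ 0 := by
      simpa using (by positivity : 0 < w ^ 3 * (1 - w) ^ 3)
    rw [← ENNReal.mul_right_inj hA0 ENNReal.ofReal_ne_top, ENNReal.ofReal_mul (by positivity),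
      mul_assoc, ← lintegral_const_mul' _ _ ENNReal.ofReal_ne_top]
    simp_rw [hrest]
    rw [hfst, hswap, hpolar, ENNReal.ofReal_mul (by positivity), ENNReal.ofReal_mul (p := w ^ 3)
      (by positivity), ← hV']
    ring
  rw [uniformBall, ← hB, lintegral_smul_measure]
  simp_rw [lintegral_smul_measure, smul_eq_mul]
  rw [lintegral_const_mul' _ _ (ENNReal.inv_ne_top.2 hV0), hJ, mul_assoc (volume B),
    ← mul_assoc _ (volume B), ENNReal.inv_mul_cancel hV0 hVt, one_mul, ← mul_assoc,
    ENNReal.inv_mul_cancel hV0 hVt, one_mul]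

end Density

/-! ### Random states -/

theorem blochVector_add (M N : Matrix (Fin 2) (Fin 2) ℂ) :
    blochVector (M + N) = blochVector M + blochVector N := by
  ext i
  simp [blochVector, add_mul]

theorem blochVector_ofReal_smul (t : ℝ) (M : Matrix (Fin 2) (Fin 2) ℂ) :
    blochVector ((t : ℂ) • M) = t • blochVector M := by
  ext i
  simp [blochVector]

theorem isDensityOf_of_map_eq {Ω : Type*} [MeasurableSpace Ω] {P : Measure Ω}
    [IsProbabilityMeasure P] {p : ℝ → ℝ} {X : Ω → ℝ} (hp : Measurable p) (hp0 : ∀ r, 0 ≤ p r)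
    (hX : AEMeasurable X P) (h : P.map X = volume.withDensity fun r ↦ ENNReal.ofReal (p r)) :
    IsDensityOf p X P := by
  have hpm : AEMeasurable (fun r ↦ ENNReal.ofReal (p r)) volume :=
    hp.ennreal_ofReal.aemeasurable
  have : HasPDF X P volume := hasPDF_of_map_eq_withDensity hX _ hpm h
  exact ⟨hp, hp0, this, (pdf.eq_of_map_eq_withDensity _ hpm).1 h⟩

/-- The length of the mixed Bloch vector has density `mixtureDensity w`. -/
theorem isDensityOf_mixtureDensity {Ω : Type*} [MeasurableSpace Ω] (P : Measure Ω)
    [IsProbabilityMeasure P] (ρ₁ ρ₂ : Ω → Matrix (Fin 2) (Fin 2) ℂ)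
    (h₁ : HasLaw ρ₁ (stateEnsemble 2 2) P) (h₂ : HasLaw ρ₂ (stateEnsemble 2 2) P)
    (hind : IndepFun ρ₁ ρ₂ P) {w : ℝ} (hw : w ∈ Ioo (1 / 2 : ℝ) 1) :
    IsDensityOf (mixtureDensity w)
      (fun ω ↦ ‖blochVector ((w : ℂ) • ρ₁ ω + ((1 - w : ℝ) : ℂ) • ρ₂ ω)‖) P := by
  have hbm := measurable_blochVector
  have hlaw (ρ : Ω → Matrix (Fin 2) (Fin 2) ℂ) (h : HasLaw ρ (stateEnsemble 2 2) P) :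
      P.map (blochVector ∘ ρ) = uniformBall := by
    rw [← AEMeasurable.map_map_of_aemeasurable hbm.aemeasurable h.aemeasurable, h.map_eq,
      map_blochVector_stateEnsemble]
  have hm₁ : AEMeasurable (blochVector ∘ ρ₁) P := hbm.comp_aemeasurable h₁.aemeasurable
  have hm₂ : AEMeasurable (blochVector ∘ ρ₂) P := hbm.comp_aemeasurable h₂.aemeasurable
  have hpair : P.map (fun ω ↦ ((blochVector ∘ ρ₁) ω, (blochVector ∘ ρ₂) ω)) =
      uniformBall.prod uniformBall := by
    rw [(indepFun_iff_map_prod_eq_prod_map_map hm₁ hm₂).1 (hind.comp hbm hbm), hlaw ρ₁ h₁,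
      hlaw ρ₂ h₂]
  have hg : Measurable fun p : EuclideanSpace ℝ (Fin 3) × EuclideanSpace ℝ (Fin 3) ↦
      ‖w • p.1 + (1 - w) • p.2‖ := by fun_prop
  have hX : (fun ω ↦ ‖blochVector ((w : ℂ) • ρ₁ ω + ((1 - w : ℝ) : ℂ) • ρ₂ ω)‖) =
      (fun p : EuclideanSpace ℝ (Fin 3) × EuclideanSpace ℝ (Fin 3) ↦
        ‖w • p.1 + (1 - w) • p.2‖) ∘ fun ω ↦ ((blochVector ∘ ρ₁) ω, (blochVector ∘ ρ₂) ω) := by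
    funext ω
    simp only [blochVector_add, blochVector_ofReal_smul, Function.comp]
  rw [hX]
  refine isDensityOf_of_map_eq (continuous_mixtureDensity hw).measurable
    (mixtureDensity_nonneg hw) (hg.comp_aemeasurable (hm₁.prodMk hm₂)) ?_
  rw [← AEMeasurable.map_map_of_aemeasurable hg.aemeasurable (hm₁.prodMk hm₂), hpair]
  have : SFinite uniformBall := by
    unfold uniformBall
    infer_instance
  ext T hT
  have hTm : Measurable (T.indicator (1 : ℝ → ENNReal)) := measurable_one.indicator hT
  rw [← lintegral_indicator_one hT, lintegral_map hTm hg, lintegral_prod _ (by fun_prop),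
    lintegral_norm_uniformBall_mixture hw hTm, withDensity_apply _ hT, ← lintegral_indicator hT]
  refine lintegral_congr fun r ↦ ?_
  by_cases hr : r ∈ T <;> simp [hr]
theorem mainTheorem2 {Ω : Type*} [MeasurableSpace Ω] (P : Measure Ω) [IsProbabilityMeasure P]
    (ρ₁ ρ₂ : Ω → Matrix (Fin 2) (Fin 2) ℂ)
    (h₁ : HasLaw ρ₁ (stateEnsemble 2 2) P) (h₂ : HasLaw ρ₂ (stateEnsemble 2 2) P)
    (hind : IndepFun ρ₁ ρ₂ P) :
    ∃ p : ℝ → ℝ → ℝ,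
      (∀ w ∈ Ioo (1 / 2 : ℝ) 1,
        IsDensityOf (p w)
          (fun ω => ‖blochVector ((w : ℂ) • ρ₁ ω + ((1 - w : ℝ) : ℂ) • ρ₂ ω)‖) P ∧
        Continuous (p w) ∧
        (∀ r ∈ Icc 0 (2 * w - 1), p w r = 3 * r ^ 2 / w ^ 3) ∧
        (∀ r ∈ Icc (2 * w - 1) 1,
          p w r = 3 * (1 - r) ^ 2 * r * (r ^ 2 + 2 * r - 12 * w ^ 2 + 12 * w - 3) /
            (16 * w ^ 3 * (1 - w) ^ 3)) ∧
        (∀ r ∉ Icc (0 : ℝ) 1, p w r = 0)) ∧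
      (∀ r ∈ Ico (0 : ℝ) 1, Tendsto (fun w => p w r) (𝓝[<] 1) (𝓝 (3 * r ^ 2))) ∧
      (∀ r ∈ Icc (0 : ℝ) 1, Tendsto (fun w => p w r) (𝓝[>] (1 / 2))
        (𝓝 (12 * r ^ 2 * (r ^ 3 - 3 * r + 2)))) := by
  refine ⟨mixtureDensity, fun w hw ↦ ⟨isDensityOf_mixtureDensity P ρ₁ ρ₂ h₁ h₂ hind hw,
    continuous_mixtureDensity hw, fun r hr ↦ mixtureDensity_of_le hr.1 hr.2,
    fun r hr ↦ mixtureDensity_of_mem_Icc hw hr, fun r hr ↦ ?_⟩,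
    fun r hr ↦ tendsto_mixtureDensity_one hr, fun r hr ↦ tendsto_mixtureDensity_half hr⟩
  rcases le_or_gt r 0 with h0 | h0
  · exact mixtureDensity_of_nonpos h0
  · exact mixtureDensity_of_one_lt hw.2.le (not_le.1 fun h1 ↦ hr ⟨h0.le, h1⟩)
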